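/- For $n\ge 1$ let $[n]=\{1,\dots,n\}$. A tuple $(x_1,\dots,x_r)$, $r\geq 1$, of elements of $[n]$ is in (weak) cyclic order if some cyclic shift $(x_{1+c},\dots,x_r,x_1,\dots,x_c)$ of it is weakly increasing, and in reversed cyclic order if some cyclic shift of it is weakly decreasing. Consider the five Cameron categories, that is, the skeletal categories of finite substructures of the five highly homogeneous relational structures (pure set, dense linear order, dense cyclic order, dense linear betweenness relation, dense separation relation). Each has objects $[n]$, $n\ge 1$, and its morphisms $[m]\to[n]$ are the following maps of sets, composed as maps: - $\mathrm{FA}$: all maps; - $\mathrm{OA}$: the order-preserving (weakly increasing) maps; - $\mathrm{CA}$: the cyclic order-preserving maps, i.e. the maps that send tuples in cyclic order to tuples in cyclic order (for all lengths $r$); - $\mathrm{BA}$: the betweenness-preserving maps, i.e. the maps that send weakly monotone (increasing or decreasing) tuples to weakly monotone tuples; these are the weakly increasing and the weakly decreasing maps; - $\mathrm{SA}$: the separation-preserving maps, i.e. the maps that send tuples in cyclic or reversed cyclic order to tuples in cyclic or reversed cyclic order (for all lengths $r$). Let $\mathcal C$ be any one of these five categories and let $k$ be a commutative ring. A $\mathcal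 C$-module is a covariant functor $V$ from $\mathcal C$ to $k$-modules. It is finitely generated if there are finitely many elements of the modules $V([n])$, $n\ge1$, that are contained in no proper submodule (subfunctor) of $V$. It is noetherian if its submodules satisfy the ascending chain condition, and it has finite length if it has a finite composition series, i.e. a finite chain of submodules $0=V_0\subset V_1\subset\dots\subset V_l=V$ with all $V_i/V_{i-1}$ simple. **Corollary.** If $k$ is noetherian, then every finitely generated $\mathcal C$-module is noetherian. If $k$ is artinian, then every finitely generated $\mathcal C$-module has finite length. -/

import Mathlib

open CategoryTheory

universe u v

namespace Cameron

/-- The five highly homogeneous relational structures: pure set, dense linear order, dense cyclic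
order, dense linear betweenness relation, dense separation relation. -/
inductive Kind
  | FA
  | OA
  | CA
  | BA
  | SA

/-- A tuple of elements of `Fin n` is in (weak) cyclic order if, after a cyclic shift of its
indices, it is weakly increasing. -/
def CyclicTuple {r n : ℕ} (x : Fin r → Fin n) : Prop :=
  ∃ c : Fin r, Monotone fun i => x (i + c)

/-- A tuple is in reversed (weak) cyclic order if, after a cyclic shift of its indices, it is
weakly decreasing. -/
def AntiCyclicTuple {r n : ℕ} (x : Fin r → Fin n) : Prop :=
  ∃ c : Fin r, Antitone fun i => x (i + c)

/-- The relations (one for each arity `r`) that the structure of each kind induces on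
`{0 < 1 < ⋯ < n - 1}`, in their weak form, which allows repeated entries.
* pure set: every tuple;
* linear order: `x₁ ≤ x₂ ≤ ⋯ ≤ x_r`;
* cyclic order: `x₁, …, x_r` are met in this order when going once around the circle;
* betweenness: linear order up to reversal;
* separation: cyclic order up to reversal. -/
def Related {r n : ℕ} : Kind → (Fin r → Fin n) → Prop
  | .FA, _ => True
  | .OA, x => Monotone x
  | .CA, x => CyclicTuple x
  | .BA, x => Monotone x ∨ Antitone x
  | .SA, x => CyclicTuple x ∨ AntiCyclicTuple x

/-- Maps that preserve the relations of the given kind, of every arity. -/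
def Preserves {m n : ℕ} (t : Kind) (f : Fin m → Fin n) : Prop :=
  ∀ (r : ℕ) (x : Fin r → Fin m), Related t x → Related t fun i => f (x i)

/-- The Cameron category of kind `t`: its objects are the sets `[n] = {0, …, n - 1}`, `n ≥ 1`. -/
@[ext]
structure Cat (t : Kind) where
  n : ℕ+

/-- Morphisms are the relation-preserving maps of sets. -/
@[ext]
structure Hom {t : Kind} (A B : Cat t) where
  toFun : Fin (A.n : ℕ) → Fin (B.n : ℕ)
  preserves : Preserves t toFun

instance (t : Kind) : Category.{0} (Cat t) where
  Hom A B := Hom A B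
  id A := ⟨fun i => i, fun _ _ h => h⟩
  comp f g := ⟨fun i => g.toFun (f.toFun i),
    fun r x h => g.preserves r _ (f.preserves r x h)⟩

/-! The following facts make the morphisms explicit: a map `f : Fin m → Fin n` (`m ≥ 1`) preserves
the relations if and only if the tuple `(f 0, …, f (m - 1))` satisfies them. -/

theorem CyclicTuple.comp {r m n : ℕ} {f : Fin m → Fin n} {x : Fin r → Fin m}
    (hf : CyclicTuple f) (hx : CyclicTuple x) : CyclicTuple fun i => f (x i) := by
  obtain ⟨d, hd⟩ := hf
  obtain ⟨c, hc⟩ := hx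
  have hr : 0 < r := c.pos
  have hm : 0 < m := d.pos
  have key : ∃ p : ℕ, p < r ∧ ((∀ i : Fin r, p ≤ i.1 → d ≤ x (i + c)) ∧
      (∀ i : Fin r, i.1 < p → x (i + c) < d) ∨
      (p = 0 ∧ ∀ i : Fin r, x (i + c) < d)) := by
    classical
    by_cases h : ∃ p : ℕ, ∃ hp : p < r, d ≤ x (⟨p, hp⟩ + c)
    · obtain ⟨hp, hp'⟩ := Nat.find_spec h
      refine ⟨Nat.find h, hp, Or.inl ⟨fun i hi => hp'.trans (hc (Fin.le_def.2 hi)), fun i hi => ?_⟩⟩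
      have := Nat.find_min h hi
      push Not at this
      exact this i.2
    · push Not at h
      exact ⟨0, hr, Or.inr ⟨rfl, fun i => h i.1 i.2⟩⟩
  obtain ⟨p, hp, hkey⟩ := key
  have hg : ∀ u : Fin m, ∃ w : Fin m, w + d = u ∧
      (w.1 = if d.1 ≤ u.1 then u.1 - d.1 else u.1 + m - d.1) := by
    intro u
    refine ⟨⟨if d.1 ≤ u.1 then u.1 - d.1 else u.1 + m - d.1, ?_⟩, ?_, rfl⟩
    · split_ifs <;> omega
    · apply Fin.ext
      rw [Fin.val_add_eq_ite]
      have := u.2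
      have := d.2
      dsimp only
      split_ifs <;> omega
  choose w hw hwv using hg
  have hfw : ∀ u, f u = f (w u + d) := fun u => by rw [hw]
  refine ⟨⟨p, hp⟩ + c, fun i j hij => ?_⟩
  have hij' : i.1 ≤ j.1 := hij
  dsimp only
  rw [hfw (x (i + _)), hfw (x (j + _))]
  refine hd (Fin.le_def.2 ?_)
  rw [hwv, hwv, ← add_assoc, ← add_assoc]
  have hi := Fin.val_add_eq_ite i ⟨p, hp⟩
  have hj := Fin.val_add_eq_ite j ⟨p, hp⟩
  generalize i + ⟨p, hp⟩ = i' at hi ⊢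
  generalize j + ⟨p, hp⟩ = j' at hj ⊢
  have hii := i.2
  have hjj := j.2
  have hxi := (x (i' + c)).2
  have hxj := (x (j' + c)).2
  have hmono : i'.1 ≤ j'.1 → (x (i' + c)).1 ≤ (x (j' + c)).1 := fun h => hc (Fin.le_def.2 h)
  dsimp only at hi hj
  rcases hkey with ⟨h1, h2⟩ | ⟨h0, h3⟩
  · have a1 : p ≤ i'.1 → d.1 ≤ (x (i' + c)).1 := h1 i'
    have a2 : i'.1 < p → (x (i' + c)).1 < d.1 := h2 i'
    have b1 : p ≤ j'.1 → d.1 ≤ (x (j' + c)).1 := h1 j'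
    have b2 : j'.1 < p → (x (j' + c)).1 < d.1 := h2 j'
    split_ifs at hi hj ⊢ <;> omega
  · have a1 : (x (i' + c)).1 < d.1 := h3 i'
    have b1 : (x (j' + c)).1 < d.1 := h3 j'
    split_ifs at hi hj ⊢ <;> omega

theorem antiCyclicTuple_iff {r n : ℕ} (x : Fin r → Fin n) :
    AntiCyclicTuple x ↔ CyclicTuple fun i => (x i).rev := by
  refine exists_congr fun c => ⟨fun h i j hij => ?_, fun h i j hij => ?_⟩
  · exact Fin.rev_le_rev.2 (h hij)
  · exact Fin.rev_le_rev.1 (h hij)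

theorem cyclicTuple_iff {r n : ℕ} (x : Fin r → Fin n) :
    CyclicTuple x ↔ AntiCyclicTuple fun i => (x i).rev := by
  simp [antiCyclicTuple_iff]

theorem CyclicTuple.comp_rev {r n : ℕ} {x : Fin r → Fin n} (hx : CyclicTuple x) :
    AntiCyclicTuple fun i => x i.rev := by
  obtain ⟨c, hc⟩ := hx
  have hr : 0 < r := c.pos
  have : ∃ e : Fin r, ∀ i : Fin r, (i + e).rev = i.rev + c := by
    refine ⟨⟨if c.1 = 0 then 0 else r - c.1, by split_ifs <;> omega⟩, fun i => Fin.ext ?_⟩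
    have := i.2
    have := c.2
    rw [Fin.val_rev, Fin.val_add_eq_ite, Fin.val_add_eq_ite, Fin.val_rev]
    dsimp only
    split_ifs <;> omega
  obtain ⟨e, he⟩ := this
  refine ⟨e, fun i j hij => ?_⟩
  dsimp only
  rw [he, he]
  exact hc (Fin.rev_le_rev.2 hij)

theorem cyclicTuple_id {m : ℕ} (hm : 0 < m) : CyclicTuple fun i : Fin m => i :=
  ⟨⟨0, hm⟩, fun i j hij => by
    have hz : ∀ i : Fin m, i + ⟨0, hm⟩ = i := fun i => Fin.ext (by
      rw [Fin.val_add_eq_ite]; have := i.2; dsimp only; split_ifs <;> omega)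
    simpa only [hz] using hij⟩

theorem Related.comp {r m n : ℕ} (t : Kind) {f : Fin m → Fin n} {x : Fin r → Fin m}
    (hf : Related t f) (hx : Related t x) : Related t fun i => f (x i) := by
  cases t with
  | FA => trivial
  | OA => exact Monotone.comp hf hx
  | CA => exact CyclicTuple.comp hf hx
  | BA =>
    rcases hf with hf | hf <;> rcases hx with hx | hx
    · exact Or.inl (hf.comp hx)
    · exact Or.inr (hf.comp_antitone hx)
    · exact Or.inr (hf.comp_monotone hx)
    · exact Or.inl (hf.comp hx)
  | SA =>
    have main : ∀ {y : Fin r → Fin m} {g : Fin m → Fin n}, CyclicTuple y →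
        (CyclicTuple g ∨ AntiCyclicTuple g) →
        (CyclicTuple (fun i => g (y i)) ∨ AntiCyclicTuple fun i => g (y i)) := by
      intro y g hy hg
      rcases hg with hg | hg
      · exact Or.inl (hg.comp hy)
      · rw [antiCyclicTuple_iff] at hg ⊢
        exact Or.inr (hg.comp hy)
    rcases hx with hx | hx
    · exact main hx hf
    · have hx' := (antiCyclicTuple_iff x).1 hx
      have hf' : CyclicTuple (fun i => f i.rev) ∨ AntiCyclicTuple fun i => f i.rev := by
        rcases hf with hf | hf
        · exact Or.inr hf.comp_rev
        · rw [antiCyclicTuple_iff] at hf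
          refine Or.inl ?_
          rw [cyclicTuple_iff]
          exact hf.comp_rev
      have := main hx' hf'
      change CyclicTuple _ ∨ AntiCyclicTuple _
      simpa only [Fin.rev_rev] using this

theorem preserves_iff_related {m n : ℕ} (hm : 0 < m) (t : Kind) (f : Fin m → Fin n) :
    Preserves t f ↔ Related t f := by
  refine ⟨fun h => h m (fun i => i) ?_, fun h r x hx => h.comp t hx⟩
  cases t with
  | FA => trivial
  | OA => exact monotone_id
  | CA => exact cyclicTuple_id hm
  | BA => exact Or.inl monotone_id
  | SA => exact Or.inl (cyclicTuple_id hm)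

/-- A functor `V` from a category to `k`-modules is finitely generated if there are finitely many
elements `x ∈ V(A)` such that the smallest subfunctor containing them, whose value at `B` is
spanned by the images of these elements under all morphisms `A ⟶ B`, is `V` itself. -/
def FinitelyGenerated {C : Type} [Category.{0} C] {k : Type u} [CommRing k]
    (V : C ⥤ ModuleCat.{v} k) : Prop :=
  ∃ S : Set (Σ A : C, V.obj A), S.Finite ∧
    ∀ B : C, Submodule.span k {y : V.obj B | ∃ p ∈ S, ∃ f : p.1 ⟶ B, V.map f p.2 = y} = ⊤

/-- An object has finite length if it has a composition series: a finite chain of subobjects from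
`0` to the whole object, each of which is maximal among the proper subobjects of the next (that
is, all successive quotients are simple). -/
def HasFiniteLength {D : Type*} [Category* D] [Abelian D] (X : D) : Prop :=
  ∃ (l : ℕ) (F : Fin (l + 1) → Subobject X), F 0 = ⊥ ∧ F (Fin.last l) = ⊤ ∧
    ∀ i : Fin l, F i.castSucc ⋖ F i.succ

end Cameron

/-!
The argument is uniform in the five categories: it uses only that their morphisms are maps of sets
and include all weakly increasing maps.

For `j ≥ 1` let `e_j : [n] → [n]` be the weakly increasing map that sends `j` to `j - 1` and fixes
all other points. It factors through `[n - 1]`, it satisfies `e_j ∘ f = f` for every map `f` whose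
image misses `j`, and `e_i e_j e_i = e_j e_i` for `j < i`. By the last relation
`(1 - e_{n - 1}) ⋯ (1 - e_1)` kills every vector fixed by one of the `e_i`
(`collapseProd_eq_zero`). If `V` is generated in degrees `≤ N` and `n ≥ N + 2`, then a map
`f : [m] → [n]` with `m ≤ N` misses some point other than `0`, so this product is zero on `V([n])`
(`collapseProd_eq_zero_of_generated`). Expanding it shows that every `x ∈ V([n])` is a linear
combination of vectors `a x`, where the `a` are weakly increasing maps that factor through
`[n - 1]`. Hence a submodule of `V` is determined by its values in degrees `≤ N + 1`
(`range_arrow_le`).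

So the submodules of `V` embed, strictly monotonically, into the submodules of the finitely
generated `k`-module `V([1]) × ⋯ × V([N + 1])`, and both chain conditions are inherited from there.
A composition series exists because both hold when `k` is artinian.
-/

namespace Cameron

variable {t : Kind} {k : Type u} [CommRing k]

/-! ### Collapsing maps -/

theorem related_of_monotone (t : Kind) {r n : ℕ} (hr : 0 < r) {f : Fin r → Fin n}
    (hf : Monotone f) : Related t f := by
  have hc : CyclicTuple f := ⟨⟨0, hr⟩, fun i j hij => hf (by
    have hz : ∀ i : Fin r, i + ⟨0, hr⟩ = i := fun i => Fin.ext (by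
      rw [Fin.val_add_eq_ite]; have := i.2; dsimp only; split_ifs <;> omega)
    simpa only [hz] using hij)⟩
  cases t with
  | FA => trivial
  | OA => exact hf
  | CA => exact hc
  | BA => exact Or.inl hf
  | SA => exact Or.inl hc

/-- A weakly increasing map, as a morphism of the Cameron category of any kind. -/
def homOfMonotone {A B : Cat t} (f : Fin (A.n : ℕ) → Fin (B.n : ℕ)) (hf : Monotone f) : A ⟶ B :=
  ⟨f, (preserves_iff_related A.n.pos t f).2 (related_of_monotone t A.n.pos hf)⟩

theorem hom_ext {A B : Cat t} {f g : A ⟶ B} (h : ∀ x, (f.toFun x : ℕ) = g.toFun x) : f = g :=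
  Hom.ext (funext fun x => Fin.ext (h x))

theorem comp_toFun {A B C : Cat t} (f : A ⟶ B) (g : B ⟶ C) (x : Fin (A.n : ℕ)) :
    (f ≫ g).toFun x = g.toFun (f.toFun x) := rfl

/-- The endomorphism `e_j` of `[n]` that sends `j` to `j - 1` and fixes all other points. It is
the identity if `j = 0` or `j ≥ n`. -/
def collapse (B : Cat t) (j : ℕ) : B ⟶ B :=
  homOfMonotone (fun x => ⟨if x.1 = j then j - 1 else x.1, by split_ifs <;> omega⟩) (by
    intro x y hxy
    have hxy' : x.1 ≤ y.1 := hxy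
    rw [Fin.le_def]
    dsimp only
    split_ifs <;> omega)

theorem collapse_toFun (B : Cat t) (j : ℕ) (x : Fin (B.n : ℕ)) :
    ((collapse B j).toFun x : ℕ) = if x.1 = j then j - 1 else x.1 := rfl

theorem collapse_comp_comp (B : Cat t) {i j : ℕ} (hij : j < i) :
    collapse B i ≫ collapse B j ≫ collapse B i = collapse B i ≫ collapse B j := by
  refine hom_ext fun x => ?_
  simp only [comp_toFun, collapse_toFun]
  split_ifs <;> omega

theorem comp_collapse {A B : Cat t} (f : A ⟶ B) {i : ℕ} (hf : ∀ x, (f.toFun x : ℕ) ≠ i) :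
    f ≫ collapse B i = f := by
  refine hom_ext fun x => ?_
  rw [comp_toFun, collapse_toFun, if_neg (hf x)]

theorem collapse_factors {A B : Cat t} (hAB : (B.n : ℕ) = A.n + 1) {j : ℕ} (hj : 0 < j)
    (hjB : j < B.n) : ∃ (s : B ⟶ A) (d : A ⟶ B), collapse B j = s ≫ d := by
  refine ⟨homOfMonotone (fun x => ⟨if x.1 < j then x.1 else x.1 - 1, by split_ifs <;> omega⟩) ?_,
    homOfMonotone (fun x => ⟨if x.1 < j then x.1 else x.1 + 1, by split_ifs <;> omega⟩) ?_,
    hom_ext fun x => ?_⟩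
  · intro x y hxy
    have hxy' : x.1 ≤ y.1 := hxy
    rw [Fin.le_def]
    dsimp only
    split_ifs <;> omega
  · intro x y hxy
    have hxy' : x.1 ≤ y.1 := hxy
    rw [Fin.le_def]
    dsimp only
    split_ifs <;> omega
  · rw [comp_toFun, collapse_toFun]
    dsimp only [homOfMonotone]
    split_ifs <;> omega

theorem exists_missed {A B : Cat t} (f : A ⟶ B) (h : (A.n : ℕ) + 2 ≤ B.n) :
    ∃ i, 0 < i ∧ i < (B.n : ℕ) ∧ ∀ x, (f.toFun x : ℕ) ≠ i := by
  by_contra! hc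
  have hsub : Finset.Ioo 0 (B.n : ℕ) ⊆ Finset.univ.image fun x => (f.toFun x : ℕ) := by
    intro i hi
    obtain ⟨h0, h1⟩ := Finset.mem_Ioo.1 hi
    obtain ⟨x, hx⟩ := hc i h0 h1
    exact Finset.mem_image.2 ⟨x, Finset.mem_univ _, hx⟩
  have := (Finset.card_le_card hsub).trans Finset.card_image_le
  rw [Nat.card_Ioo, Finset.card_univ, Fintype.card_fin] at this
  omega

/-! ### The product of the complementary operators -/

variable (V : Cat t ⥤ ModuleCat.{v} k)

/-- The operator `(1 - e_l) ⋯ (1 - e_1)` on `V(B)`. The order of the factors matters, as the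
`e_j` do not commute. -/
def collapseProd (B : Cat t) : ℕ → Module.End k (V.obj B)
  | 0 => LinearMap.id
  | l + 1 => (LinearMap.id - (V.map (collapse B (l + 1))).hom) ∘ₗ collapseProd B l

theorem collapseProd_zero (B : Cat t) (x : V.obj B) : collapseProd V B 0 x = x := rfl

theorem collapseProd_succ (B : Cat t) (l : ℕ) (x : V.obj B) :
    collapseProd V B (l + 1) x =
      collapseProd V B l x - V.map (collapse B (l + 1)) (collapseProd V B l x) := rfl

/-- The vectors fixed by `e_i` are stable under `e_j` for `j < i`, so they stay fixed by `e_i` until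
the factor `1 - e_i` is applied. -/
theorem collapseProd_eq_zero (B : Cat t) {i l : ℕ} (hi : 0 < i) (hil : i ≤ l) {x : V.obj B}
    (hx : V.map (collapse B i) x = x) : collapseProd V B l x = 0 := by
  have hfix : ∀ l < i, V.map (collapse B i) (collapseProd V B l x) = collapseProd V B l x := by
    intro l
    induction l with
    | zero => exact fun _ => hx
    | succ l ih =>
      intro hl
      have hy := ih (by omega)
      rw [collapseProd_succ, map_sub, hy]
      congr 1
      have h := congrArg (fun f => V.map f (collapseProd V B l x)) (collapse_comp_comp B hl)
      simpa only [Functor.map_comp, ConcreteCategory.comp_apply, hy] using h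
  induction l, hil using Nat.le_induction with
  | base =>
    obtain ⟨i, rfl⟩ := Nat.exists_eq_add_one_of_ne_zero hi.ne'
    rw [collapseProd_succ, hfix i (by omega), sub_self]
  | succ l _ ih => rw [collapseProd_succ, ih, map_zero, sub_zero]

theorem collapseProd_eq_zero_of_generated {S : Set (Σ A : Cat t, V.obj A)} {B : Cat t}
    (hS : ∀ p ∈ S, (p.1.n : ℕ) + 2 ≤ B.n)
    (hB : Submodule.span k {y : V.obj B | ∃ p ∈ S, ∃ f : p.1 ⟶ B, V.map f p.2 = y} = ⊤)
    (x : V.obj B) : collapseProd V B (B.n - 1) x = 0 := by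
  suffices h : Submodule.span k {y : V.obj B | ∃ p ∈ S, ∃ f : p.1 ⟶ B, V.map f p.2 = y} ≤
      LinearMap.ker (collapseProd V B (B.n - 1)) by
    rw [hB] at h
    exact LinearMap.mem_ker.1 (h Submodule.mem_top)
  rw [Submodule.span_le]
  rintro _ ⟨p, hp, f, rfl⟩
  obtain ⟨i, hi0, hiB, hi⟩ := exists_missed f (hS p hp)
  refine LinearMap.mem_ker.2 (collapseProd_eq_zero V B hi0 (by omega) ?_)
  rw [← ConcreteCategory.comp_apply, ← Functor.map_comp, comp_collapse f hi]

/-! ### Submodules are determined in low degrees -/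

theorem map_mem_range_arrow (X : Subobject V) {A B : Cat t} (f : A ⟶ B) {x : V.obj A}
    (hx : x ∈ LinearMap.range (X.arrow.app A).hom) :
    V.map f x ∈ LinearMap.range (X.arrow.app B).hom := by
  obtain ⟨y, rfl⟩ := hx
  exact ⟨(X : Cat t ⥤ ModuleCat.{v} k).map f y, NatTrans.naturality_apply X.arrow f y⟩

/-- Beyond the degrees of the generators (with one degree to spare), an inclusion between
submodules of `V` propagates from `[n]` to `[n + 1]`. -/
theorem range_arrow_le_succ {S : Set (Σ A : Cat t, V.obj A)} {A B : Cat t}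
    (hAB : (B.n : ℕ) = A.n + 1) (hS : ∀ p ∈ S, (p.1.n : ℕ) + 2 ≤ B.n)
    (hB : Submodule.span k {y : V.obj B | ∃ p ∈ S, ∃ f : p.1 ⟶ B, V.map f p.2 = y} = ⊤)
    {X Y : Subobject V}
    (h : LinearMap.range (X.arrow.app A).hom ≤ LinearMap.range (Y.arrow.app A).hom) :
    LinearMap.range (X.arrow.app B).hom ≤ LinearMap.range (Y.arrow.app B).hom := by
  intro x hx
  have key : ∀ l, l < (B.n : ℕ) →
      collapseProd V B l x ∈ LinearMap.range (X.arrow.app B).hom ∧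
      x - collapseProd V B l x ∈ LinearMap.range (Y.arrow.app B).hom := by
    intro l
    induction l with
    | zero =>
      intro _
      rw [collapseProd_zero, sub_self]
      exact ⟨hx, zero_mem _⟩
    | succ l ih =>
      intro hl
      obtain ⟨h1, h2⟩ := ih (by omega)
      rw [collapseProd_succ, sub_sub_eq_add_sub, add_sub_right_comm]
      refine ⟨sub_mem h1 (map_mem_range_arrow V X _ h1), add_mem h2 ?_⟩
      obtain ⟨s, d, hsd⟩ := collapse_factors hAB (Nat.succ_pos l) hl
      rw [hsd, Functor.map_comp, ConcreteCategory.comp_apply]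
      exact map_mem_range_arrow V Y d (h (map_mem_range_arrow V X s h1))
  have := (key (B.n - 1) (by have := B.n.pos; omega)).2
  rwa [collapseProd_eq_zero_of_generated V hS hB, sub_zero] at this

theorem range_arrow_le {S : Set (Σ A : Cat t, V.obj A)} {N : ℕ} (hS : ∀ p ∈ S, (p.1.n : ℕ) ≤ N)
    (hV : ∀ B : Cat t,
      Submodule.span k {y : V.obj B | ∃ p ∈ S, ∃ f : p.1 ⟶ B, V.map f p.2 = y} = ⊤)
    {X Y : Subobject V}
    (h : ∀ i ≤ N, LinearMap.range (X.arrow.app ⟨i.succPNat⟩).hom ≤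
      LinearMap.range (Y.arrow.app ⟨i.succPNat⟩).hom) (B : Cat t) :
    LinearMap.range (X.arrow.app B).hom ≤ LinearMap.range (Y.arrow.app B).hom := by
  have key : ∀ i : ℕ, LinearMap.range (X.arrow.app ⟨i.succPNat⟩).hom ≤
      LinearMap.range (Y.arrow.app ⟨i.succPNat⟩).hom := by
    intro i
    induction i with
    | zero => exact h 0 (Nat.zero_le N)
    | succ i ih =>
      by_cases hi : i + 1 ≤ N
      · exact h _ hi
      · refine range_arrow_le_succ V rfl (fun p hp => ?_) (hV _) ih
        have := hS p hp
        simp only [Nat.succPNat_coe]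
        omega
  obtain ⟨i, rfl⟩ : ∃ i : ℕ, B = ⟨i.succPNat⟩ :=
    ⟨B.n.natPred, Cat.ext (PNat.succPNat_natPred B.n).symm⟩
  exact key i

theorem eq_of_range_arrow_le {X Y : Subobject V} (hXY : X ≤ Y)
    (h : ∀ B, LinearMap.range (Y.arrow.app B).hom ≤ LinearMap.range (X.arrow.app B).hom) :
    X = Y := by
  have : ∀ B, Epi ((X.ofLE Y hXY).app B) := by
    intro B
    rw [ModuleCat.epi_iff_surjective]
    intro y
    obtain ⟨x, hx⟩ := h B ⟨y, rfl⟩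
    refine ⟨x, ?_⟩
    have hinj : Function.Injective (Y.arrow.app B) :=
      (ModuleCat.mono_iff_injective _).1 inferInstance
    apply hinj
    rw [← ConcreteCategory.comp_apply, ← NatTrans.comp_app, Subobject.ofLE_arrow]
    exact hx
  have : Epi (X.ofLE Y hXY) := NatTrans.epi_of_epi_app _
  have : IsIso (X.ofLE Y hXY) := isIso_of_mono_of_epi _
  exact le_antisymm hXY (Subobject.le_of_comm (inv (X.ofLE Y hXY)) (by simp))

/-! ### Chain conditions -/

theorem finite_obj (hV : FinitelyGenerated V) (B : Cat t) : Module.Finite k (V.obj B) := by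
  obtain ⟨S, hS, hspan⟩ := hV
  refine ⟨Submodule.fg_def.2 ⟨_, ?_, hspan B⟩⟩
  have : ∀ A : Cat t, Finite (A ⟶ B) := fun A =>
    Finite.of_injective (fun f : A ⟶ B => f.toFun) fun _ _ h => Hom.ext h
  refine (hS.biUnion fun p _ => Set.finite_range fun f : p.1 ⟶ B => V.map f p.2).subset ?_
  rintro y ⟨p, hp, f, hf⟩
  exact Set.mem_biUnion hp ⟨f, hf⟩

/-- The submodules of a finitely generated `V` embed into the submodules of a finite product of
values of `V`. -/
theorem exists_strictMono (hV : FinitelyGenerated V) :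
    ∃ (N : ℕ) (φ : Subobject V → Submodule k (∀ i : Fin (N + 1), V.obj ⟨i.1.succPNat⟩)),
      StrictMono φ := by
  obtain ⟨S, hS, hspan⟩ := hV
  obtain ⟨N, hN⟩ := (hS.image fun p => (p.1.n : ℕ)).bddAbove
  have hN' : ∀ p ∈ S, (p.1.n : ℕ) ≤ N := fun p hp => hN ⟨p, hp, rfl⟩
  let φ : Subobject V → Submodule k (∀ i : Fin (N + 1), V.obj ⟨i.1.succPNat⟩) := fun X =>
    Submodule.pi Set.univ fun i => LinearMap.range (X.arrow.app ⟨i.1.succPNat⟩).hom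
  have hφ : Monotone φ := by
    intro X Y hXY
    refine Submodule.pi_mono fun i _ => ?_
    rintro _ ⟨x, rfl⟩
    refine ⟨(X.ofLE Y hXY).app _ x, ?_⟩
    conv_rhs => rw [← Subobject.ofLE_arrow hXY]
    rfl
  refine ⟨N, φ, fun X Y hXY => lt_of_le_not_ge (hφ hXY.le) fun hle => hXY.ne ?_⟩
  refine eq_of_range_arrow_le V hXY.le (range_arrow_le V hN' hspan fun i hi y hy => ?_)
  let j : Fin (N + 1) := ⟨i, Nat.lt_succ_of_le hi⟩
  have hmem : Pi.single (M := fun i : Fin (N + 1) => V.obj ⟨i.1.succPNat⟩) j y ∈ φ Y := by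
    rw [Submodule.mem_pi]
    intro a _
    by_cases ha : a = j
    · subst ha
      rwa [Pi.single_eq_same]
    · rw [Pi.single_eq_of_ne ha]
      exact zero_mem _
  have := Submodule.mem_pi.1 (hle hmem) j (Set.mem_univ _)
  rwa [Pi.single_eq_same] at this

theorem hasFiniteLength_of_wellFounded {D : Type*} [Category* D] [Abelian D] (X : D)
    [WellFoundedLT (Subobject X)] [WellFoundedGT (Subobject X)] : HasFiniteLength X := by
  obtain ⟨a, h0, l, hl, ha⟩ :=
    exists_covBy_seq_of_wellFoundedLT_wellFoundedGT_of_le (bot_le : (⊥ : Subobject X) ≤ ⊤)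
  exact ⟨l, fun i => a i, h0, hl, fun i => ha i i.2⟩

end Cameron

theorem mainTheorem2 {k : Type u} [CommRing k] (t : Cameron.Kind)
    (V : Cameron.Cat t ⥤ ModuleCat.{v} k) (hV : Cameron.FinitelyGenerated V) :
    (IsNoetherianRing k → IsNoetherianObject V) ∧
      (IsArtinianRing k → Cameron.HasFiniteLength V) := by
  obtain ⟨N, φ, hφ⟩ := Cameron.exists_strictMono V hV
  have hfin := Cameron.finite_obj V hV
  have hnoeth : IsNoetherianRing k → WellFoundedGT (Subobject V) := fun _ => hφ.wellFoundedGT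
  refine ⟨fun h => ⟨hnoeth h⟩, fun h => ?_⟩
  have := hnoeth inferInstance
  have : WellFoundedLT (Subobject V) := hφ.wellFoundedLT
  exact Cameron.hasFiniteLength_of_wellFounded V
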